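/- Let $X$ be a complex Banach space. A linear relation $T$ in $X$ (written $T\in LR(X)$) is a multivalued map whose graph $G(T)=\{(x,y) : y\in Tx\}$ is a linear subspace of $X\times X$; its domain $D(T)=\{x : Tx\neq\emptyset\}$ may be any subspace. Put $N(T)=\{x : 0\in Tx\}$, $R(T)=\bigcup_x Tx$, $T(0)=\{y : (0,y)\in G(T)\}$, and define sums by $(T+K)x=Tx+Kx$ for $x\in D(T)\cap D(K)$. Call $T$ closed if $G(T)$ is closed; Fredholm if $T$ is closed, $R(T)$ is closed, and $\dim N(T)$ and $\dim X/R(T)$ are finite, in which case its index is $\kappa(T)=\dim N(T)-\dim X/R(T)$. Call $K\in LR(X)$ compact if the image under $QK$ of the closed unit ball of $D(K)$ is relatively compact, where $Q:X\to X/\overline{K(0)}$ is the quotient map. The resolvent set $\rho(T)$ is the set of $\lambda\in\mathbb C$ for which $(\lambda-T)^{-1}$ is a single-valued, everywhere defined bounded operator, and $\sigma(T)=\mathbb C\setminus\rho(T)$. Let $$\sigma_{e4}(T)=\mathbb C\setminus\{\lambda\in\mathbb C : \lambda-T \text{ is Fredholm and } \kappa(\lambda-T)=0\}.$$ Proposition.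 Let $T\in LR(X)$ be closed. Then $$\sigma_{e4}(T)=\bigcap_{K\in\mathcal K_T}\sigma(T+K),$$ where $\mathcal K_T$ is the set of all compact $K\in LR(X)$ with $D(K)\supseteq D(T)$ and $K(0)\subseteq\overline{T(0)}$. -/

import Mathlib

/-- A linear relation (multivalued linear operator) from `X` to `Y`: a relation whose graph is
a linear subspace of `X × Y`. The domain may be any subspace of `X`. -/
@[ext]
structure LinearRelation (X Y : Type*) [AddCommGroup X] [Module ℂ X]
    [AddCommGroup Y] [Module ℂ Y] where
  /-- The graph `G(T) = {(x, y) | y ∈ T x}`. -/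
  graph : Submodule ℂ (X × Y)

namespace LinearRelation

section Algebra

variable {X Y : Type*} [AddCommGroup X] [Module ℂ X] [AddCommGroup Y] [Module ℂ Y]

/-- The domain `D(T) = {x | T x ≠ ∅}`. -/
def dom (T : LinearRelation X Y) : Submodule ℂ X := T.graph.map (LinearMap.fst ℂ X Y)

/-- The range `R(T) = ⋃ x, T x`. -/
def range (T : LinearRelation X Y) : Submodule ℂ Y := T.graph.map (LinearMap.snd ℂ X Y)

/-- The null space `N(T) = {x | 0 ∈ T x}`. -/
def ker (T : LinearRelation X Y) : Submodule ℂ X := T.graph.comap (LinearMap.inl ℂ X Y)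

/-- The multivalued part `T(0) = {y | y ∈ T 0}`. -/
def mulPart (T : LinearRelation X Y) : Submodule ℂ Y := T.graph.comap (LinearMap.inr ℂ X Y)

/-- The inverse relation `T⁻¹`, with graph `{(y, x) | (x, y) ∈ G(T)}`. -/
def inverse (T : LinearRelation X Y) : LinearRelation Y X where
  graph := T.graph.comap (LinearEquiv.prodComm ℂ Y X).toLinearMap

/-- The single-valued, everywhere defined relation given by a linear map. -/
def ofLinearMap (A : X →ₗ[ℂ] Y) : LinearRelation X Y where
  graph := A.graph

/-- The sum of relations, `(T + S) x = T x + S x` for `x ∈ D(T) ∩ D(S)`. -/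
instance : Add (LinearRelation X Y) where
  add T S :=
    { graph :=
        { carrier := {p | ∃ y z, (p.1, y) ∈ T.graph ∧ (p.1, z) ∈ S.graph ∧ y + z = p.2}
          zero_mem' := ⟨0, 0, T.graph.zero_mem, S.graph.zero_mem, add_zero 0⟩
          add_mem' := by
            rintro p q ⟨y, z, hy, hz, h⟩ ⟨y', z', hy', hz', h'⟩
            refine ⟨y + y', z + z', T.graph.add_mem hy hy', S.graph.add_mem hz hz', ?_⟩
            rw [Prod.snd_add, ← h, ← h', add_add_add_comm]
          smul_mem' := by
            rintro c p ⟨y, z, hy, hz, h⟩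
            refine ⟨c • y, c • z, T.graph.smul_mem c hy, S.graph.smul_mem c hz, ?_⟩
            rw [Prod.smul_snd, ← h, smul_add] } }

/-- The relation `-T`, with `(-T) x = {-y | y ∈ T x}`. -/
instance : Neg (LinearRelation X Y) where
  neg T := { graph := T.graph.map (LinearMap.prodMap LinearMap.id (-LinearMap.id)) }

/-- The difference of relations, `T - S = T + (-S)`. -/
instance : Sub (LinearRelation X Y) where
  sub T S := T + -S

/-- The relation `c - T`, that is `c I - T` with `I` the identity on `X`. -/
def scalarSub (c : ℂ) (T : LinearRelation X X) : LinearRelation X X :=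
  ofLinearMap (c • LinearMap.id) - T

end Algebra

section Normed

variable {X Y : Type*} [NormedAddCommGroup X] [NormedSpace ℂ X]
  [NormedAddCommGroup Y] [NormedSpace ℂ Y]

/-- A relation is closed if its graph is closed in `X × Y`. -/
def IsClosedRel (T : LinearRelation X Y) : Prop := IsClosed (T.graph : Set (X × Y))

/-- `T` is compact if `Q T` maps the unit ball of `D(T)` to a relatively compact set, where
`Q` is the quotient map from `Y` onto `Y` modulo the closure of `T(0)`. -/
def IsCompactRel (T : LinearRelation X Y) : Prop :=
  IsCompact (closure
    {q : Y ⧸ T.mulPart.topologicalClosure |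
      ∃ x y, (x, y) ∈ T.graph ∧ ‖x‖ ≤ 1 ∧ T.mulPart.topologicalClosure.mkQ y = q})

/-- `T` is a Fredholm relation: it is closed, has closed range, and its null space and the
quotient of `Y` by its range are finite dimensional. -/
structure IsFredholm (T : LinearRelation X Y) : Prop where
  isClosedRel : T.IsClosedRel
  isClosed_range : IsClosed (T.range : Set Y)
  finite_ker : FiniteDimensional ℂ T.ker
  finite_coker : FiniteDimensional ℂ (Y ⧸ T.range)

/-- The index `dim N(T) - dim Y / R(T)`, used for Fredholm relations, where both
dimensions are finite. -/
noncomputable def index (T : LinearRelation X Y) : ℤ :=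
  (Module.finrank ℂ T.ker : ℤ) - (Module.finrank ℂ (Y ⧸ T.range) : ℤ)

/-- The resolvent set: those `c` for which `(c - T)⁻¹` is single-valued, everywhere defined
and bounded. -/
def resolventSet (T : LinearRelation X X) : Set ℂ :=
  {c | ∃ A : X →L[ℂ] X, (scalarSub c T).inverse = ofLinearMap (A : X →ₗ[ℂ] X)}

/-- The spectrum `σ(T)`. -/
def spectrum (T : LinearRelation X X) : Set ℂ := T.resolventSetᶜ

/-- The essential resolvent set `ρ_{e4}(T)`. -/
def essResolventSet4 (T : LinearRelation X X) : Set ℂ :=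
  {c | (scalarSub c T).IsFredholm ∧ (scalarSub c T).index = 0}

/-- The essential spectrum `σ_{e4}(T)`. -/
def essSpectrum4 (T : LinearRelation X X) : Set ℂ := T.essResolventSet4ᶜ

/-- The admissible perturbations of `T`: compact relations `K` with `D(T) ⊆ D(K)` and with
`K(0)` contained in the closure of `T(0)`. -/
def compactPerturbations (T : LinearRelation X X) : Set (LinearRelation X X) :=
  {K | K.IsCompactRel ∧ T.dom ≤ K.dom ∧ K.mulPart ≤ T.mulPart.topologicalClosure}

end Normed

end LinearRelation

/-! Fix c and write U = c - T. If c lies in the resolvent set of T + K, with resolvent A, then A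
vanishes exactly on U(0) and factors through an injective map A₁ on X / U(0). Modulo U(0), U A₁ = 1
+ C with C induced by the compact K A₁, so U inherits kernel and cokernel from 1 + C, and
Riesz–Schauder (`IsCompactOperator.isFredholm_one_add`) makes it Fredholm of index 0. Conversely,
index 0 gives an isomorphism from N(U) onto a complement of R(U). Composed with a projection onto
N(U), it is a finite-rank F with U + F bijective, and K = -F moves c into the resolvent set. -/

open Module

/-! ### Riesz–Schauder theory of 1 + C. -/

section Riesz

variable {Z : Type*} [NormedAddCommGroup Z] [NormedSpace ℂ Z]

/-- The correction of `V` by a map factoring through a projection onto its kernel is injective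
exactly when the induced map from the kernel to the cokernel is. -/
theorem LinearMap.injective_add_comp_proj {V : Z →ₗ[ℂ] Z} {P : Z →ₗ[ℂ] V.ker}
    {F : V.ker →ₗ[ℂ] Z} (hP : ∀ n : V.ker, P n = n) :
    Function.Injective (V + F ∘ₗ P) ↔ Function.Injective (V.range.mkQ ∘ₗ F) := by
  rw [← LinearMap.ker_eq_bot, ← LinearMap.ker_eq_bot, LinearMap.ker_eq_bot',
    LinearMap.ker_eq_bot']
  constructor
  · intro h n hn
    have hn' : F n ∈ V.range := by simpa using hn
    obtain ⟨w, hw⟩ := hn'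
    have hVn : V n = 0 := n.2
    have hVw : V (P w) = 0 := (P w).2
    -- `w - P w` has the same image `F n` as `w` but projection 0, so `V` and `F ∘ P` cancel on this
    -- vector.
    have key := h (n - (w - P w)) (by simp [hP, hVn, hVw, hw])
    have := congrArg P key
    simpa [hP] using this
  · intro h x hx
    have hx' : V x + F (P x) = 0 := hx
    have hPx : P x = 0 := by
      apply h
      rw [LinearMap.comp_apply, Submodule.mkQ_apply, Submodule.Quotient.mk_eq_zero]
      exact ⟨-x, by rw [map_neg, neg_eq_iff_add_eq_zero, hx']⟩
    have hVx : V x = 0 := by simpa [hPx] using hx'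
    have := hP ⟨x, hVx⟩
    rw [hPx] at this
    exact (congrArg Subtype.val this).symm

theorem LinearMap.surjective_add_comp_proj {V : Z →ₗ[ℂ] Z} {P : Z →ₗ[ℂ] V.ker}
    {F : V.ker →ₗ[ℂ] Z} (hP : ∀ n : V.ker, P n = n) :
    Function.Surjective (V + F ∘ₗ P) ↔ Function.Surjective (V.range.mkQ ∘ₗ F) := by
  constructor
  · intro h q
    obtain ⟨y, rfl⟩ := V.range.mkQ_surjective q
    obtain ⟨x, rfl⟩ := h y
    refine ⟨P x, ?_⟩
    simp
  · intro h y
    obtain ⟨n, hn⟩ := h (V.range.mkQ y)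
    have hy : y - F n ∈ V.range := by
      rw [← Submodule.Quotient.mk_eq_zero, Submodule.Quotient.mk_sub, sub_eq_zero]
      exact hn.symm
    obtain ⟨w, hw⟩ := hy
    have hVn : V n = 0 := n.2
    have hVw : V (P w) = 0 := (P w).2
    exact ⟨w - P w + n, by simp [hP, hVn, hVw, hw]⟩

variable {C : Z →L[ℂ] Z}

/-- On the kernel `C` acts as -1, so the identity there is compact. -/
theorem IsCompactOperator.finiteDimensional_ker_one_add (hC : IsCompactOperator C) :
    FiniteDimensional ℂ (1 + C).ker := by
  have hCx : ∀ x ∈ (1 + C).ker, C x = -x := fun x hx =>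
    (neg_eq_of_add_eq_zero_right (by simpa using hx)).symm
  have hV : ∀ v ∈ (1 + C).ker, (C : Z →ₗ[ℂ] Z) v ∈ (1 + C).ker := fun v hv => by
    rw [ContinuousLinearMap.coe_coe, hCx v hv]
    exact neg_mem hv
  have h := (IsCompactOperator.restrict (f := (C : Z →ₗ[ℂ] Z)) hC hV (1 + C).isClosed_ker).neg
  have hid : -⇑((C : Z →ₗ[ℂ] Z).restrict hV) = id := by
    funext x
    refine Subtype.ext ?_
    change -C x = x
    rw [hCx x x.2, neg_neg]
  rw [hid] at h
  exact FiniteDimensional.of_isCompactOperator_id h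

variable [CompleteSpace Z]

theorem IsCompactOperator.bijective_one_add_of_injective (hC : IsCompactOperator C)
    (h : Function.Injective (1 + C : Z →L[ℂ] Z)) : Function.Bijective (1 + C : Z →L[ℂ] Z) := by
  rcases hasEigenvalue_or_mem_resolventSet hC (μ := -1) (by simp) with h' | h'
  · obtain ⟨x, hx⟩ := h'.exists_hasEigenvector
    refine absurd (h (a₁ := x) (a₂ := 0) ?_) hx.2
    have : C x = (-1 : ℂ) • x := hx.apply_eq_smul
    simp [this]
  · rw [_root_.spectrum.mem_resolventSet_iff] at h'
    have h2 : IsUnit (1 + C) := by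
      have := h'.neg
      convert this using 1
      simp [add_comm]
    exact ContinuousLinearMap.isUnit_iff_bijective.1 h2

/-- A right inverse satisfies S = 1 - C S, an injective compact perturbation of 1. By the injective
case S is onto, which makes it a two-sided inverse. -/
theorem IsCompactOperator.bijective_one_add_of_surjective (hC : IsCompactOperator C)
    (h : Function.Surjective (1 + C : Z →L[ℂ] Z)) : Function.Bijective (1 + C : Z →L[ℂ] Z) := by
  have := hC.finiteDimensional_ker_one_add
  obtain ⟨P, hP⟩ := Submodule.ClosedComplemented.of_finiteDimensional (1 + C).ker
  -- a bounded right inverse of `1 + C`, from the open mapping theorem on `ker P`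
  let f : P.ker →L[ℂ] Z := (1 + C) ∘L P.ker.subtypeL
  have hf : f.ker = ⊥ := by
    rw [LinearMap.ker_eq_bot']
    rintro ⟨x, hx⟩ h0
    have hx' : P x = 0 := hx
    have hPx := hP ⟨x, h0⟩
    rw [hx'] at hPx
    ext
    exact (congrArg Subtype.val hPx).symm
  have hf' : f.range = ⊤ := by
    rw [LinearMap.range_eq_top]
    intro y
    obtain ⟨w, hw⟩ := h y
    refine ⟨⟨w - P w, show P (w - P w) = 0 by rw [map_sub, hP (P w), sub_self]⟩, ?_⟩
    have : (1 + C) (P w : Z) = 0 := (P w).2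
    change (1 + C) (w - P w) = y
    rw [map_sub, this, hw, sub_zero]
  have : CompleteSpace P.ker := P.isClosed_ker.completeSpace_coe
  let e := ContinuousLinearEquiv.ofBijective f hf hf'
  let S : Z →L[ℂ] Z := P.ker.subtypeL ∘L e.symm.toContinuousLinearMap
  have hS : ∀ y, (1 + C) (S y) = y := fun y => e.apply_symm_apply y
  have hS' : S = 1 + (-(C ∘L S)) := by
    ext y
    have := hS y
    simp only [add_apply, one_apply_eq_self] at this
    simp [← sub_eq_add_neg, eq_sub_iff_add_eq, this]
  have hSb : Function.Bijective S := by
    have hc : IsCompactOperator (-(C ∘L S) : Z →L[ℂ] Z) := (hC.comp_clm S).neg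
    rw [hS']
    apply hc.bijective_one_add_of_injective
    rw [← hS']
    exact Function.LeftInverse.injective hS
  refine ⟨fun x y hxy => ?_, h⟩
  obtain ⟨a, rfl⟩ := hSb.2 x
  obtain ⟨b, rfl⟩ := hSb.2 y
  rw [hS, hS] at hxy
  rw [hxy]

/-- Riesz–Schauder: a compact perturbation of the identity has closed range of finite
codimension, equal to the dimension of the kernel. -/
theorem IsCompactOperator.isFredholm_one_add (hC : IsCompactOperator C) :
    IsClosed ((1 + C).range : Set Z) ∧ FiniteDimensional ℂ (Z ⧸ (1 + C).range) ∧
      finrank ℂ (1 + C).ker = finrank ℂ (Z ⧸ (1 + C).range) := by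
  have := hC.finiteDimensional_ker_one_add
  obtain ⟨P, hP⟩ := Submodule.ClosedComplemented.of_finiteDimensional (1 + C).ker
  obtain ⟨s, hs⟩ := (1 + C).range.mkQ.exists_rightInverse_of_surjective (1 + C).range.range_mkQ
  -- The finite-rank correction built from `j` is again 1 + compact, so one half of bijectivity
  -- forces the other, and this passes back to `j`.
  have key : ∀ j : (1 + C).ker →ₗ[ℂ] Z ⧸ (1 + C).range,
      Function.Injective j ∨ Function.Surjective j → Function.Bijective j ∧
        Function.Bijective (1 + C + (s ∘ₗ j).toContinuousLinearMap ∘L P : Z →L[ℂ] Z) := by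
    intro j hj
    have hj' : (1 + C).range.mkQ ∘ₗ (s ∘ₗ j) = j := by
      rw [← LinearMap.comp_assoc, hs, LinearMap.id_comp]
    have hi := LinearMap.injective_add_comp_proj (V := (1 + C : Z →L[ℂ] Z).toLinearMap)
      (P := P.toLinearMap) (F := s ∘ₗ j) hP
    have hsu := LinearMap.surjective_add_comp_proj (V := (1 + C : Z →L[ℂ] Z).toLinearMap)
      (P := P.toLinearMap) (F := s ∘ₗ j) hP
    rw [hj'] at hi hsu
    have hc : IsCompactOperator (C + (s ∘ₗ j).toContinuousLinearMap ∘L P : Z →L[ℂ] Z) :=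
      hC.add ((isCompactOperator_of_locallyCompactSpace_rng
        (s ∘ₗ j).toContinuousLinearMap).comp_clm P)
    have hb : Function.Bijective (1 + C + (s ∘ₗ j).toContinuousLinearMap ∘L P : Z →L[ℂ] Z) := by
      rw [add_assoc]
      rcases hj with h | h
      · apply hc.bijective_one_add_of_injective
        rw [← add_assoc]
        exact hi.2 h
      · apply hc.bijective_one_add_of_surjective
        rw [← add_assoc]
        exact hsu.2 h
    exact ⟨⟨hi.1 hb.1, hsu.1 hb.2⟩, hb⟩
  -- The cokernel is not yet known to be finite dimensional, hence cardinal ranks are compared.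
  have hj : ∃ j : (1 + C).ker →ₗ[ℂ] Z ⧸ (1 + C).range,
      Function.Injective j ∨ Function.Surjective j := by
    rcases le_total (Module.rank ℂ (1 + C).ker) (Module.rank ℂ (Z ⧸ (1 + C).range)) with h | h
    · obtain ⟨j, hj⟩ := rank_le_iff_exists_linearMap.1 h
      exact ⟨j, .inl hj⟩
    · obtain ⟨i, hi⟩ := rank_le_iff_exists_linearMap.1 h
      obtain ⟨j, hj⟩ := i.exists_leftInverse_of_injective (LinearMap.ker_eq_bot.2 hi)
      exact ⟨j, .inr fun q => ⟨i q, LinearMap.congr_fun hj q⟩⟩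
  obtain ⟨j, hj⟩ := hj
  obtain ⟨hjb, hW⟩ := key j hj
  let e := LinearEquiv.ofBijective j hjb
  refine ⟨?_, e.finiteDimensional, e.finrank_eq⟩
  let W := ContinuousLinearEquiv.ofBijective (1 + C + (s ∘ₗ j).toContinuousLinearMap ∘L P)
    (LinearMap.ker_eq_bot.2 hW.1) (LinearMap.range_eq_top.2 hW.2)
  have hWP : ∀ x, P x = 0 → W x = (1 + C) x := fun x hx => by
    change (1 + C) x + (s ∘ₗ j) (P x) = (1 + C) x
    rw [hx, map_zero, add_zero]
  -- `W` agrees with 1 + C on ker P, a complement of the kernel, and is a homeomorphism.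
  have : ((1 + C).range : Set Z) = W '' (P.ker : Set Z) := by
    ext y
    constructor
    · rintro ⟨x, rfl⟩
      have hx : P (x - P x) = 0 := by rw [map_sub, hP (P x), sub_self]
      refine ⟨x - P x, hx, ?_⟩
      have : (1 + C) (P x : Z) = 0 := (P x).2
      rw [hWP _ hx, map_sub, this, sub_zero]
      rfl
    · rintro ⟨x, hx, rfl⟩
      exact ⟨x, (hWP x hx).symm⟩
  rw [this]
  exact W.toHomeomorph.isClosedMap _ P.isClosed_ker

end Riesz

/-! ### Algebra of linear relations. -/

namespace LinearRelation

section Algebra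

variable {X Y : Type*} [AddCommGroup X] [Module ℂ X] [AddCommGroup Y] [Module ℂ Y]

theorem mem_dom {T : LinearRelation X Y} {x : X} : x ∈ T.dom ↔ ∃ y, (x, y) ∈ T.graph := by
  simp [dom]

theorem mem_range {T : LinearRelation X Y} {y : Y} : y ∈ T.range ↔ ∃ x, (x, y) ∈ T.graph := by
  simp [range]

theorem mem_ker {T : LinearRelation X Y} {x : X} : x ∈ T.ker ↔ (x, 0) ∈ T.graph := Iff.rfl

theorem mem_mulPart {T : LinearRelation X Y} {y : Y} : y ∈ T.mulPart ↔ (0, y) ∈ T.graph :=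
  Iff.rfl

theorem mem_graph_add {T S : LinearRelation X Y} {x : X} {y : Y} :
    (x, y) ∈ (T + S).graph ↔ ∃ t s, (x, t) ∈ T.graph ∧ (x, s) ∈ S.graph ∧ t + s = y := Iff.rfl

theorem mem_graph_neg {T : LinearRelation X Y} {x : X} {y : Y} :
    (x, y) ∈ (-T).graph ↔ (x, -y) ∈ T.graph := by
  change (x, y) ∈ T.graph.map (LinearMap.prodMap LinearMap.id (-LinearMap.id)) ↔ _
  constructor
  · rintro ⟨⟨a, b⟩, h, hab⟩
    obtain ⟨rfl, rfl⟩ : a = x ∧ -b = y := by simpa using hab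
    simpa using h
  · intro h
    exact ⟨_, h, by simp⟩

theorem mem_graph_scalarSub {T : LinearRelation X X} {c : ℂ} {x y : X} :
    (x, y) ∈ (scalarSub c T).graph ↔ (x, c • x - y) ∈ T.graph := by
  change (x, y) ∈ (ofLinearMap (c • LinearMap.id) + -T).graph ↔ _
  rw [mem_graph_add]
  constructor
  · rintro ⟨t, s, ht, hs, rfl⟩
    rw [mem_graph_neg] at hs
    have : t = c • x := by simpa [ofLinearMap] using ht
    simpa [this] using hs
  · intro h
    refine ⟨c • x, y - c • x, by simp [ofLinearMap], ?_, by simp⟩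
    rw [mem_graph_neg]
    simpa using h

theorem sub_mem_mulPart {T : LinearRelation X Y} {x : X} {y z : Y} (hy : (x, y) ∈ T.graph)
    (hz : (x, z) ∈ T.graph) : y - z ∈ T.mulPart := by
  simpa [mem_mulPart] using T.graph.sub_mem hy hz

/-- A relation composed with a linear map into its domain becomes a linear map modulo any
subspace containing the multivalued part. -/
theorem exists_linearMap_mkQ {E : Type*} [AddCommGroup E] [Module ℂ E] {K : LinearRelation X Y}
    {N : Submodule ℂ Y} (hN : K.mulPart ≤ N) (f : E →ₗ[ℂ] X) (hf : ∀ e, f e ∈ K.dom) :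
    ∃ g : E →ₗ[ℂ] Y ⧸ N, ∀ e y, (f e, y) ∈ K.graph → g e = N.mkQ y := by
  choose k hk using fun e => mem_dom.1 (hf e)
  have hu : ∀ e y, (f e, y) ∈ K.graph → N.mkQ (k e) = N.mkQ y := fun e y hy =>
    (Submodule.Quotient.eq N).2 (hN (sub_mem_mulPart (hk e) hy))
  refine ⟨{ toFun := fun e => N.mkQ (k e), map_add' := fun a b => ?_, map_smul' := fun r a => ?_ },
    hu⟩
  · rw [← map_add]
    refine hu _ _ ?_
    rw [map_add]
    exact K.graph.add_mem (hk a) (hk b)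
  · rw [RingHom.id_apply, ← map_smul]
    refine hu _ _ ?_
    rw [map_smul]
    exact K.graph.smul_mem r (hk a)

end Algebra

/-! ### Compact and closed relations. -/

section Normed

variable {X Y : Type*} [NormedAddCommGroup X] [NormedSpace ℂ X]
  [NormedAddCommGroup Y] [NormedSpace ℂ Y]

/-- By continuity `f` sends a neighbourhood of 0 into the unit ball, whose image under `K` is
relatively compact modulo the closure of K(0), hence also modulo the larger `N`. -/
theorem IsCompactRel.isCompactOperator {E : Type*} [NormedAddCommGroup E] [NormedSpace ℂ E]
    {K : LinearRelation X Y} (hK : K.IsCompactRel) {N : Submodule ℂ Y}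
    (hN : K.mulPart.topologicalClosure ≤ N) {f : E →L[ℂ] X} (hf : ∀ e, f e ∈ K.dom)
    {g : E →ₗ[ℂ] Y ⧸ N} (hg : ∀ e y, (f e, y) ∈ K.graph → g e = N.mkQ y) :
    IsCompactOperator g := by
  let q : (Y ⧸ K.mulPart.topologicalClosure) →L[ℂ] Y ⧸ N :=
    K.mulPart.topologicalClosure.liftQL N.mkQL (by simpa using hN)
  refine ⟨_, hK.image q.continuous, ?_⟩
  have hball : f ⁻¹' Metric.closedBall 0 1 ∈ nhds (0 : E) :=
    f.continuous.continuousAt.preimage_mem_nhds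
      (by rw [map_zero]; exact Metric.closedBall_mem_nhds 0 one_pos)
  filter_upwards [hball] with e he
  obtain ⟨y, hy⟩ := mem_dom.1 (hf e)
  refine ⟨K.mulPart.topologicalClosure.mkQ y, subset_closure ⟨f e, y, hy, by simpa using he, rfl⟩,
    ?_⟩
  rw [hg e y hy]
  rfl

theorem isCompactRel_ofLinearMap {A : X →L[ℂ] Y} (hA : IsCompactOperator A) :
    (ofLinearMap (A : X →ₗ[ℂ] Y)).IsCompactRel := by
  obtain ⟨s, hs, hAs⟩ := IsCompactOperator.image_closedBall_subset_compact
    (f := (A : X →ₗ[ℂ] Y)) hA 1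
  set M := (ofLinearMap (A : X →ₗ[ℂ] Y)).mulPart.topologicalClosure
  have : IsClosed (M : Set Y) := Submodule.isClosed_topologicalClosure _
  refine (hs.image M.mkQL.continuous).closure_of_subset ?_
  rintro _ ⟨x, y, hxy, hx, rfl⟩
  have hy : y = A x := by simpa [ofLinearMap] using hxy
  exact ⟨y, hAs ⟨x, by simpa using hx, hy.symm⟩, rfl⟩

theorem IsClosedRel.isClosed_mulPart {T : LinearRelation X Y} (hT : T.IsClosedRel) :
    IsClosed (T.mulPart : Set Y) :=
  IsClosed.preimage (f := fun y => ((0 : X), y)) (by fun_prop) hT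

theorem IsClosedRel.scalarSub {T : LinearRelation X X} (hT : T.IsClosedRel) (c : ℂ) :
    (scalarSub c T).IsClosedRel := by
  have : ((T.scalarSub c).graph : Set (X × X)) =
      (fun p : X × X => (p.1, c • p.1 - p.2)) ⁻¹' T.graph := by
    ext ⟨x, y⟩
    exact mem_graph_scalarSub
  rw [IsClosedRel, this]
  exact IsClosed.preimage (by fun_prop) hT

theorem mem_graph_scalarSub_add {T K : LinearRelation X X} {c : ℂ} {x y : X} :
    (x, y) ∈ (scalarSub c (T + K)).graph ↔
      ∃ u k, (x, u) ∈ (scalarSub c T).graph ∧ (x, k) ∈ K.graph ∧ u - k = y := by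
  rw [mem_graph_scalarSub, mem_graph_add]
  constructor
  · rintro ⟨t, k, ht, hk, h⟩
    refine ⟨c • x - t, k, by simpa [mem_graph_scalarSub] using ht, hk, ?_⟩
    rw [sub_sub, h, sub_sub_cancel]
  · rintro ⟨u, k, hu, hk, rfl⟩
    exact ⟨c • x - u, k, mem_graph_scalarSub.1 hu, hk, by abel⟩

theorem mem_mulPart_scalarSub {T : LinearRelation X X} {c : ℂ} {y : X} :
    y ∈ (scalarSub c T).mulPart ↔ y ∈ T.mulPart := by
  rw [mem_mulPart, mem_graph_scalarSub, mem_mulPart, smul_zero, zero_sub]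
  exact ⟨fun h => by simpa using T.graph.neg_mem h, fun h => by simpa using T.graph.neg_mem h⟩

/-! ### The two inclusions. -/

variable [CompleteSpace X]

theorem resolventSet_add_subset_essResolventSet4 {T K : LinearRelation X X} (hT : T.IsClosedRel)
    (hK : K ∈ T.compactPerturbations) : (T + K).resolventSet ⊆ T.essResolventSet4 := by
  rintro c ⟨A, hA⟩
  obtain ⟨hKc, hdom, hmul⟩ := hK
  have hA' : ∀ x y, A y = x ↔
      ∃ u k, (x, u) ∈ (scalarSub c T).graph ∧ (x, k) ∈ K.graph ∧ u - k = y := fun x y => by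
    rw [← mem_graph_scalarSub_add]
    change _ ↔ (y, x) ∈ (scalarSub c (T + K)).inverse.graph
    rw [hA]
    simp [ofLinearMap, eq_comm]
  change (scalarSub c T).IsFredholm ∧ (scalarSub c T).index = 0
  have hU := hT.scalarSub c
  have hUdom : ∀ {x u}, (x, u) ∈ (scalarSub c T).graph → x ∈ K.dom := fun h =>
    hdom (mem_dom.2 ⟨_, mem_graph_scalarSub.1 h⟩)
  have hNcl : IsClosed ((scalarSub c T).mulPart : Set X) := hU.isClosed_mulPart
  have hKN : K.mulPart ≤ (scalarSub c T).mulPart := fun y hy => by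
    have := hmul hy
    rw [hT.isClosed_mulPart.submodule_topologicalClosure_eq] at this
    exact mem_mulPart_scalarSub.2 this
  generalize scalarSub c T = U at *
  let N := U.mulPart
  have hAdom : ∀ y, A y ∈ K.dom := fun y => by
    obtain ⟨u, k, hu, -, -⟩ := (hA' _ y).1 rfl
    exact hUdom hu
  -- The kernel of the inverse is (U - K)(0), which is U(0) because K(0) ⊆ U(0).
  have hker : N = A.ker := by
    ext y
    constructor
    · intro hy
      exact (hA' 0 y).2 ⟨y, 0, hy, K.graph.zero_mem, sub_zero y⟩
    · intro hy
      obtain ⟨u, k, hu, hk, rfl⟩ := (hA' 0 y).1 hy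
      exact N.sub_mem hu (hKN hk)
  let A₁ : (X ⧸ N) →L[ℂ] X := N.liftQL A hker.le
  have hA₁inj : Function.Injective A₁ := by
    refine LinearMap.ker_eq_bot (f := A₁.toLinearMap).1 ?_
    exact Submodule.ker_liftQ_eq_bot _ _ _ hker.ge
  have hA₁dom : ∀ z, A₁ z ∈ K.dom := fun z => by
    obtain ⟨y, rfl⟩ := N.mkQ_surjective z
    exact hAdom y
  have : IsClosed (N : Set X) := hNcl
  obtain ⟨g, hg⟩ := exists_linearMap_mkQ hKN A₁.toLinearMap hA₁dom
  have hgc : IsCompactOperator g := hKc.isCompactOperator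
    (K.mulPart.topologicalClosure_minimal hKN hNcl) hA₁dom hg
  let C : (X ⧸ N) →L[ℂ] X ⧸ N := ⟨g, hgc.continuous⟩
  have hC : IsCompactOperator C := hgc
  -- Modulo `N`, U = (U - K) + K: on A₁ z the first term gives z and the second C z.
  have hgraph : ∀ z u, (A₁ z, u) ∈ U.graph ↔ (1 + C) z = N.mkQ u := by
    intro z u
    obtain ⟨y, rfl⟩ := N.mkQ_surjective z
    obtain ⟨v, k, hv, hk, rfl⟩ := (hA' _ y).1 rfl
    have h1 : (1 + C) (N.mkQ (v - k)) = N.mkQ v := by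
      have : C (N.mkQ (v - k)) = N.mkQ k := hg _ _ hk
      rw [add_apply, this, one_apply_eq_self, map_sub,
        sub_add_cancel]
    rw [h1]
    refine Iff.trans ?_ (Submodule.Quotient.eq N).symm
    constructor
    · intro h
      exact sub_mem_mulPart hv h
    · intro h
      have := U.graph.sub_mem hv (mem_mulPart.1 h)
      rwa [Prod.mk_sub_mk, sub_zero, sub_sub_cancel] at this
  have hdomU : ∀ {x u}, (x, u) ∈ U.graph → ∃ z, A₁ z = x := fun {x u} h => by
    obtain ⟨k, hk⟩ := mem_dom.1 (hUdom h)
    exact ⟨N.mkQ (u - k), (hA' _ _).2 ⟨u, k, h, hk, rfl⟩⟩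
  have hrange : U.range = (1 + C).range.comap N.mkQ := by
    ext u
    rw [mem_range]
    constructor
    · rintro ⟨x, hx⟩
      obtain ⟨z, rfl⟩ := hdomU hx
      exact ⟨z, (hgraph z u).1 hx⟩
    · rintro ⟨z, hz⟩
      exact ⟨A₁ z, (hgraph z u).2 hz⟩
  have hkerU : U.ker = (1 + C).ker.map A₁.toLinearMap := by
    ext x
    constructor
    · intro hx
      obtain ⟨z, rfl⟩ := hdomU hx
      exact ⟨z, by simpa using (hgraph z 0).1 hx, rfl⟩
    · rintro ⟨z, hz, rfl⟩
      exact (hgraph z 0).2 (by simpa using hz)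
  obtain ⟨hcl, hfin, hdim⟩ := hC.isFredholm_one_add
  have hfk := hC.finiteDimensional_ker_one_add
  let ek := Submodule.equivMapOfInjective A₁.toLinearMap hA₁inj (1 + C).ker
  rw [← hkerU] at ek
  let ec : (X ⧸ U.range) ≃ₗ[ℂ] (X ⧸ N) ⧸ (1 + C).range :=
    (Submodule.quotEquivOfEq _ _ (by rw [LinearMap.ker_comp, Submodule.ker_mkQ, hrange])).trans
      (((1 + C).range.mkQ ∘ₗ N.mkQ).quotKerEquivOfSurjective
        ((1 + C).range.mkQ_surjective.comp N.mkQ_surjective))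
  refine ⟨⟨hU, ?_, ek.finiteDimensional, ec.symm.finiteDimensional⟩, ?_⟩
  · rw [hrange]
    exact hcl.preimage N.mkQL.continuous
  · rw [index, ← ek.finrank_eq, ec.finrank_eq, hdim, sub_self]

theorem exists_mem_resolventSet_add_of_mem_essResolventSet4 {T : LinearRelation X X} {c : ℂ}
    (hc : c ∈ T.essResolventSet4) :
    ∃ K ∈ T.compactPerturbations, c ∈ (T + K).resolventSet := by
  obtain ⟨⟨hcl, -, hk, hr⟩, hi⟩ := hc
  have hdim : finrank ℂ (scalarSub c T).ker = finrank ℂ (X ⧸ (scalarSub c T).range) := by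
    simpa [index, sub_eq_zero] using hi
  -- The condition says that U + F = c - (T + (-F)) has a single-valued, everywhere defined inverse.
  -- Its graph is closed since that of U is, so the closed graph theorem bounds it.
  suffices h : ∃ F : X →L[ℂ] X, IsCompactOperator F ∧
      ∀ y, ∃! x, (x, y - F x) ∈ (scalarSub c T).graph by
    obtain ⟨F, hF, hu⟩ := h
    choose A hA hAu using hu
    have hA' : ∀ x y, A y = x ↔ (x, y - F x) ∈ (scalarSub c T).graph := fun x y =>
      ⟨by rintro rfl; exact hA y, fun h => (hAu y x h).symm⟩
    let A₁ : X →ₗ[ℂ] X :=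
      { toFun := A
        map_add' := fun y z => by
          rw [hA', map_add, add_sub_add_comm]
          exact (scalarSub c T).graph.add_mem (hA y) (hA z)
        map_smul' := fun r y => by
          rw [hA', RingHom.id_apply, map_smul, ← smul_sub]
          exact (scalarSub c T).graph.smul_mem r (hA y) }
    have hA₁ : IsClosed (A₁.graph : Set (X × X)) := by
      have : (A₁.graph : Set (X × X)) =
          (fun p : X × X => (p.2, p.1 - F p.2)) ⁻¹' (scalarSub c T).graph := by
        ext ⟨y, x⟩
        exact eq_comm.trans (hA' x y)
      rw [this]
      exact IsClosed.preimage (by fun_prop) hcl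
    refine ⟨ofLinearMap (-F : X →L[ℂ] X).toLinearMap,
      ⟨isCompactRel_ofLinearMap hF.neg, ?_, ?_⟩, ContinuousLinearMap.ofIsClosedGraph hA₁, ?_⟩
    · intro x _
      exact mem_dom.2 ⟨-F x, rfl⟩
    · intro y hy
      have : y = 0 := by simpa [ofLinearMap, mem_mulPart] using hy
      rw [this]
      exact zero_mem _
    · rw [ContinuousLinearMap.coe_ofIsClosedGraph]
      ext ⟨y, x⟩
      refine Iff.trans ?_ (eq_comm.trans ((hA' x y))).symm
      change (x, y) ∈ (scalarSub c _).graph ↔ _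
      rw [mem_graph_scalarSub_add]
      constructor
      · rintro ⟨u, k, hu, hk, rfl⟩
        have : k = -F x := hk
        simpa [this] using hu
      · intro h
        exact ⟨_, -F x, h, rfl, by simp⟩
  generalize scalarSub c T = U at *
  obtain ⟨P, hP⟩ := Submodule.ClosedComplemented.of_finiteDimensional U.ker
  obtain ⟨s, hs⟩ := U.range.mkQ.exists_rightInverse_of_surjective U.range.range_mkQ
  let j := LinearEquiv.ofFinrankEq U.ker (X ⧸ U.range) hdim
  have hs' : ∀ n, U.range.mkQ (s (j n)) = j n := fun n => LinearMap.congr_fun hs _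
  -- F = s j P carries N(U) isomorphically onto the complement s(X / R(U)) of R(U).
  refine ⟨(s ∘ₗ j.toLinearMap).toContinuousLinearMap ∘L P,
    (isCompactOperator_of_locallyCompactSpace_rng
      (s ∘ₗ j.toLinearMap).toContinuousLinearMap).comp_clm P, fun y => ?_⟩
  change ∃! x, (x, y - s (j (P x))) ∈ U.graph
  refine existsUnique_of_exists_of_unique ?_ ?_
  · obtain ⟨n, hn⟩ := j.surjective (U.range.mkQ y)
    have hy : y - s (j n) ∈ U.range := by
      rw [← Submodule.Quotient.mk_eq_zero, Submodule.Quotient.mk_sub, sub_eq_zero]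
      exact hn.symm.trans (hs' n).symm
    obtain ⟨w, hw⟩ := mem_range.1 hy
    refine ⟨w - P w + n, ?_⟩
    have := U.graph.add_mem (U.graph.sub_mem hw (mem_ker.1 (P w).2)) (mem_ker.1 n.2)
    simpa [hP] using this
  · intro x x' hx hx'
    have h0 := U.graph.sub_mem hx hx'
    have h1 : (x - x', -s (j (P (x - x')))) ∈ U.graph := by simpa using h0
    have hP0 : P (x - x') = 0 := by
      apply j.injective
      rw [map_zero, ← hs', Submodule.mkQ_apply, Submodule.Quotient.mk_eq_zero, ← neg_mem_iff]
      exact mem_range.2 ⟨_, h1⟩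
    have hker : x - x' ∈ U.ker := by simpa [hP0, mem_ker] using h1
    have := hP ⟨_, hker⟩
    rw [hP0] at this
    exact sub_eq_zero.1 (congrArg Subtype.val this).symm

end Normed

end LinearRelation

theorem mainTheorem4 {X : Type*} [NormedAddCommGroup X] [NormedSpace ℂ X] [CompleteSpace X]
    (T : LinearRelation X X) (hT : T.IsClosedRel) :
    T.essSpectrum4 = ⋂ K ∈ T.compactPerturbations, (T + K).spectrum := by
  ext c
  simp only [Set.mem_iInter, LinearRelation.essSpectrum4, LinearRelation.spectrum, Set.mem_compl_iff]
  constructor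
  · intro h K hK hc
    exact h (LinearRelation.resolventSet_add_subset_essResolventSet4 hT hK hc)
  · intro h hc
    obtain ⟨K, hK, hcK⟩ := LinearRelation.exists_mem_resolventSet_add_of_mem_essResolventSet4 hc
    exact h K hK hcK
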